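/- For a Borel probability measure $\mu$ on $\mathbb R^n$ say that $\mu$ is *log-concave* if $\mu(\lambda A+(1-\lambda)B)\ge \mu(A)^{\lambda}\mu(B)^{1-\lambda}$ for all compact $A,B\subseteq\mathbb R^n$ and $0<\lambda<1$, and *isotropic* if it has mean zero and identity covariance. Let $\psi_n$ be the KLS constant in dimension $n$, that is, $$\psi_n=\sup_{\mu}\ \sup_{A}\ \frac{\min\{\mu(A),1-\mu(A)\}}{\mu^+(A)},\qquad \mu^+(A)=\liminf_{\varepsilon\downarrow 0}\frac{\mu(A_\varepsilon)-\mu(A)}{\varepsilon},$$ where $\mu$ ranges over the isotropic log-concave probability measures on $\mathbb R^n$, $A$ over the Borel sets with $0<\mu(A)<1$, and $A_\varepsilon$ is the open Euclidean $\varepsilon$-neighbourhood of $A$. There is a universal constant $c>0$ such that the following holds. Let $n\ge 0$, let $\mathcal N$ be a semi-norm on $\mathbb R^n$, and let $Z$ be a random vector in $\mathbb R^n$ whose distribution is symmetric (that is, $-Z$ and $Z$ have the same law) and log-concave. Then $\mathbb E[\mathcal N(Z)]<\infty$, and for every $t>0$, $$\mathbb P\big(\,|\mathcal N(Z)-\mathbb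 E[\mathcal N(Z)]|>t\,\big)\ \le\ 2\exp\left(-\frac{c}{\psi_n}\cdot\frac{t}{\mathbb E[\mathcal N(Z)]}\right).$$ Here $c/\psi_n$ and $t/\mathbb E[\mathcal N(Z)]$ are read in $[0,\infty]$ with $x/0=\infty$ for $x>0$, $c/\infty=0$, $0\cdot\infty=0$ and $e^{-\infty}=0$; in particular, if $\psi_n<\infty$ and $\mathbb E[\mathcal N(Z)]=0$, the right-hand side is $0$. -/

import Mathlib

open MeasureTheory Filter Topology
open scoped ENNReal Pointwise

/-- A Borel measure on a real vector space is log-concave if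
`μ(aA + bB) ≥ μ(A)^a μ(B)^b` for all compact `A`, `B` and all weights `a, b > 0`, `a + b = 1`.
(The sum `a • A + b • B` is the Minkowski sum.) -/
def IsLogConcave {E : Type*} [AddCommGroup E] [Module ℝ E] [TopologicalSpace E]
    [MeasurableSpace E] (μ : Measure E) : Prop :=
  ∀ A B : Set E, IsCompact A → IsCompact B → ∀ a b : ℝ, 0 < a → 0 < b → a + b = 1 →
    μ A ^ a * μ B ^ b ≤ μ (a • A + b • B)

/-- A measure on `ℝⁿ` is isotropic if it is centered and its covariance matrix is the identity. -/
def IsIsotropic {n : ℕ} (μ : Measure (EuclideanSpace ℝ (Fin n))) : Prop :=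
  ∀ θ : EuclideanSpace ℝ (Fin n),
    ∫ x, inner ℝ x θ ∂μ = 0 ∧ ∫ x, (inner ℝ x θ) ^ 2 ∂μ = ‖θ‖ ^ 2

/-- The boundary measure of `A` (lower Minkowski content with respect to `μ`):
`liminf_{ε ↓ 0} (μ(A_ε) - μ(A)) / ε`, where `A_ε` is the open `ε`-neighbourhood of `A`. -/
noncomputable def boundaryMeasure {n : ℕ} (μ : Measure (EuclideanSpace ℝ (Fin n)))
    (A : Set (EuclideanSpace ℝ (Fin n))) : ℝ≥0∞ :=
  liminf (fun ε : ℝ => (μ (Metric.thickening ε A) - μ A) / ENNReal.ofReal ε) (𝓝[>] 0)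

/-- The Cheeger (isoperimetric) constant of a probability measure `μ` on `ℝⁿ`: the infimum of
`μ⁺(A) / min (μ(A), 1 - μ(A))` over Borel sets `A` with `0 < μ(A) < 1`. -/
noncomputable def cheegerConstant {n : ℕ} (μ : Measure (EuclideanSpace ℝ (Fin n))) : ℝ≥0∞ :=
  ⨅ (A : Set (EuclideanSpace ℝ (Fin n))) (_ : MeasurableSet A) (_ : 0 < μ A) (_ : μ A < 1),
    boundaryMeasure μ A / min (μ A) (1 - μ A)

/-- The KLS constant `ψ_n`: the supremum of the reciprocal Cheeger constants of the isotropic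
log-concave probability measures on `ℝⁿ`. -/
noncomputable def klsConstant (n : ℕ) : ℝ≥0∞ :=
  ⨆ (μ : Measure (EuclideanSpace ℝ (Fin n))) (_ : IsProbabilityMeasure μ) (_ : IsIsotropic μ)
    (_ : IsLogConcave μ), (cheegerConstant μ)⁻¹

/-! Let `μ` be the law of `Z`; symmetry serves only to centre it. Write `μ` as the image under a
linear map `L` of an isotropic log-concave `ν` on the same `ℝⁿ`
(`IsLogConcave.exists_isotropic_lift`). Then `N ∘ L` is Lipschitz with constant `(∫ N² dμ)^(1/2)`: a
functional `θ` supporting `N` at `L x` satisfies `‖L* θ‖² = ∫ ⟪x, θ⟫² dμ ≤ ∫ N² dμ` by isotropy of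
`ν` (`seminorm_comp_le`). Borell's lemma bounds this constant by a universal multiple of the mean of
`N` (`exists_integral_seminorm_sq_le`).

The Cheeger constant of `ν` is at least `1 / ψ_n`, and isoperimetry forces exponential concentration
of Lipschitz functions at that rate, first about a median and then about the mean
(`measureReal_abs_sub_integral_gt_le`). Rescaling `N ∘ L` gives the claim.

If the covariance of `μ` is singular, whitening leaves some directions without mass. They are filled
by independent uniform variables, which `L` kills. That this preserves log-concavity is a
one-dimensional Prékopa–Leindler argument (`IsLogConcave.smear`). The dimension stays `n`, so `ψ_n`
need not be compared across dimensions. -/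

/-! ### Log-concavity on Borel sets, and moments of semi-norms -/

/-- Inner regularity passes from compact to Borel sets. The superset `C` avoids asking whether a
Minkowski sum of Borel sets is measurable. -/
theorem IsLogConcave.rpow_mul_rpow_le {n : ℕ} {μ : Measure (EuclideanSpace ℝ (Fin n))}
    [IsFiniteMeasure μ] (hμ : IsLogConcave μ) {A B C : Set (EuclideanSpace ℝ (Fin n))}
    (hA : MeasurableSet A) (hB : MeasurableSet B) {a b : ℝ} (ha : 0 < a) (hb : 0 < b)
    (hab : a + b = 1) (hC : a • A + b • B ⊆ C) : μ A ^ a * μ B ^ b ≤ μ C := by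
  refine ENNReal.mul_le_of_forall_lt fun r hr s hs => ?_
  have hr' : r ^ a⁻¹ < μ A := by
    rwa [ENNReal.rpow_inv_lt_iff ha]
  have hs' : s ^ b⁻¹ < μ B := by
    rwa [ENNReal.rpow_inv_lt_iff hb]
  obtain ⟨K, hKA, hK, hrK⟩ := hA.exists_lt_isCompact hr'
  obtain ⟨K', hKB, hK', hsK⟩ := hB.exists_lt_isCompact hs'
  rw [ENNReal.rpow_inv_lt_iff ha] at hrK
  rw [ENNReal.rpow_inv_lt_iff hb] at hsK
  calc r * s ≤ μ K ^ a * μ K' ^ b := mul_le_mul' hrK.le hsK.le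
    _ ≤ μ (a • K + b • K') := hμ K K' hK hK' a b ha hb hab
    _ ≤ μ C := measure_mono ((Set.add_subset_add (Set.smul_set_mono hKA)
        (Set.smul_set_mono hKB)).trans hC)

theorem IsLogConcave.map_linear {n : ℕ} {μ : Measure (EuclideanSpace ℝ (Fin n))}
    [IsFiniteMeasure μ] (hμ : IsLogConcave μ)
    (T : EuclideanSpace ℝ (Fin n) →L[ℝ] EuclideanSpace ℝ (Fin n)) :
    IsLogConcave (μ.map T) := by
  intro A B hA hB a b ha hb hab
  have hT : Measurable T := T.continuous.measurable
  rw [Measure.map_apply hT hA.measurableSet, Measure.map_apply hT hB.measurableSet,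
    Measure.map_apply hT ((hA.smul a).add (hB.smul b)).measurableSet]
  refine hμ.rpow_mul_rpow_le (hT hA.measurableSet) (hT hB.measurableSet) ha hb hab ?_
  rintro _ ⟨_, ⟨x, hx, rfl⟩, _, ⟨y, hy, rfl⟩, rfl⟩
  refine ⟨a • T x, ⟨T x, hx, rfl⟩, b • T y, ⟨T y, hy, rfl⟩, by simp⟩

theorem Seminorm.continuous_euclidean {n : ℕ} (N : Seminorm ℝ (EuclideanSpace ℝ (Fin n))) :
    Continuous N := by
  rw [← continuousOn_univ]
  exact N.convexOn.continuousOn isOpen_univ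

/-- Borell's lemma: a seminorm has exponential tails under a log-concave probability measure. -/
theorem IsLogConcave.measure_seminorm_gt_le {n : ℕ} {μ : Measure (EuclideanSpace ℝ (Fin n))}
    [IsProbabilityMeasure μ] (hμ : IsLogConcave μ) (N : Seminorm ℝ (EuclideanSpace ℝ (Fin n)))
    {s : ℝ} (hs : 0 < s) (hNs : μ {x | s < N x} ≤ 3⁻¹) {r : ℝ} (hr : 1 < r) :
    μ {x | r * s < N x} ≤ 2⁻¹ ^ ((r + 1) / 2) := by
  have hN : Measurable N := N.continuous_euclidean.measurable
  -- The weights solve `a * (r * s) - b * s = s`, so averaging a point of `{r * s < N}` with one of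
  -- `{N ≤ s}` lands in `{s < N}`.
  set a := 2 / (r + 1) with ha
  set b := (r - 1) / (r + 1) with hb
  have hr1 : 0 < r + 1 := by linarith
  have ha0 : 0 < a := by positivity
  have hb0 : 0 < b := div_pos (by linarith) hr1
  have hab : a + b = 1 := by rw [ha, hb]; field_simp; ring
  have hcompl : μ {x | N x ≤ s} = 1 - μ {x | s < N x} := by
    rw [← prob_compl_eq_one_sub (measurableSet_lt measurable_const hN)]
    congr 1; ext x; simp
  have hK : 2 * 3⁻¹ ≤ μ {x | N x ≤ s} := by
    rw [hcompl]
    refine le_trans ?_ (tsub_le_tsub_left hNs 1)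
    refine ENNReal.le_sub_of_add_le_right (by simp) ?_
    rw [← add_one_mul, show (2 + 1 : ℝ≥0∞) = 3 by norm_num]
    exact (ENNReal.mul_inv_cancel (by simp) (by simp)).le
  have key := hμ.rpow_mul_rpow_le (measurableSet_lt measurable_const hN : MeasurableSet
    {x | r * s < N x}) (measurableSet_le hN measurable_const : MeasurableSet {x | N x ≤ s})
    ha0 hb0 hab (C := {x | s < N x}) (by
      rintro _ ⟨_, ⟨x, hx, rfl⟩, _, ⟨y, hy, rfl⟩, rfl⟩
      simp only [Set.mem_ofPred_eq] at hx hy ⊢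
      have h1 : a * N x ≤ N (a • x + b • y) + b * N y := by
        have := map_sub_le_add N (a • x + b • y) (b • y)
        simp only [add_sub_cancel_right, map_smul_eq_mul, Real.norm_eq_abs, abs_of_pos ha0,
          abs_of_pos hb0] at this
        exact this
      have h2 : a * (r * s) < a * N x := mul_lt_mul_of_pos_left hx ha0
      have h3 : b * N y ≤ b * s := mul_le_mul_of_nonneg_left hy hb0.le
      have h4 : a * (r * s) - b * s = s := by rw [ha, hb]; field_simp; ring
      linarith)
  -- Replacing the exponent `b` by `1` makes this factor independent of `r`; dividing `1/3` by `2/3`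
  -- then leaves `1/2`.
  have h5 : (2 * 3⁻¹ : ℝ≥0∞) ≤ μ {x | N x ≤ s} ^ b := by
    calc (2 * 3⁻¹ : ℝ≥0∞) ≤ μ {x | N x ≤ s} := hK
      _ = μ {x | N x ≤ s} ^ (1 : ℝ) := by simp
      _ ≤ _ := ENNReal.rpow_le_rpow_of_exponent_ge prob_le_one (by linarith)
  have h6 : μ {x | r * s < N x} ^ a ≤ 2⁻¹ := by
    have : μ {x | r * s < N x} ^ a * (2 * 3⁻¹) ≤ 3⁻¹ :=
      (mul_le_mul_right h5 _).trans (key.trans hNs)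
    rw [← mul_assoc] at this
    have h7 := (ENNReal.mul_le_mul_iff_left (c := 3⁻¹) (by simp) (by simp)).1
      (this.trans (one_mul _).ge)
    exact ENNReal.le_inv_iff_mul_le.2 h7
  calc μ {x | r * s < N x} = (μ {x | r * s < N x} ^ a) ^ ((r + 1) / 2) := by
        rw [← ENNReal.rpow_mul, ha]; field_simp; simp
    _ ≤ _ := ENNReal.rpow_le_rpow h6 (by positivity)

theorem exists_summable_layer_constant :
    ∃ C : ℝ, 0 < C ∧ ∑' k : ℕ, ENNReal.ofReal (2 * k + 1) * (2 * (2⁻¹ : ℝ≥0∞) ^ ((k : ℝ) / 2)) ≤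
      ENNReal.ofReal C := by
  set q : ℝ := (2⁻¹ : ℝ) ^ (2⁻¹ : ℝ) with hq
  have hq0 : 0 < q := by positivity
  have hq1 : q < 1 := Real.rpow_lt_one (by norm_num) (by norm_num) (by norm_num)
  have hqn : ‖q‖ < 1 := by rwa [Real.norm_of_nonneg hq0.le]
  have hsum : Summable fun k : ℕ => (2 * (k : ℝ) + 1) * (2 * q ^ k) := by
    have h1 := (summable_pow_mul_geometric_of_norm_lt_one 1 hqn).mul_left 4
    have h2 := (summable_geometric_of_norm_lt_one hqn).mul_left 2
    refine (h1.add h2).congr fun k => ?_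
    simp; ring
  refine ⟨∑' k : ℕ, (2 * (k : ℝ) + 1) * (2 * q ^ k), ?_, ?_⟩
  · exact hsum.tsum_pos (fun k => by positivity) 0 (by simp)
  · rw [ENNReal.ofReal_tsum_of_nonneg (fun k => by positivity) hsum]
    refine ENNReal.tsum_le_tsum fun k => le_of_eq ?_
    rw [ENNReal.ofReal_mul (by positivity), ENNReal.ofReal_mul (by positivity)]
    congr 2
    · simp
    · rw [hq, ← Real.rpow_natCast, ← Real.rpow_mul (by norm_num),
        ← ENNReal.ofReal_rpow_of_pos (by norm_num), ENNReal.ofReal_inv_of_pos (by norm_num)]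
      congr 1
      · simp
      · ring

/-- The second moment of a seminorm under a log-concave probability measure is controlled by
any upper quantile. -/
theorem exists_lintegral_seminorm_sq_le : ∃ C : ℝ, 0 < C ∧
    ∀ {n : ℕ} {μ : Measure (EuclideanSpace ℝ (Fin n))} [IsProbabilityMeasure μ],
      IsLogConcave μ → ∀ (N : Seminorm ℝ (EuclideanSpace ℝ (Fin n))) {s : ℝ}, 0 < s →
        μ {x | s < N x} ≤ 3⁻¹ → ∫⁻ x, ENNReal.ofReal (N x ^ 2) ∂μ ≤ ENNReal.ofReal (C * s ^ 2) := by
  obtain ⟨C, hC, hCle⟩ := exists_summable_layer_constant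
  refine ⟨C, hC, fun {n μ} _ hμ N {s} hs hNs => ?_⟩
  have hN : Measurable N := N.continuous_euclidean.measurable
  have hmeas (k : ℕ) : MeasurableSet {x | k * s < N x} := measurableSet_lt measurable_const hN
  -- The factor `2` makes the bound trivial for `k = 0, 1`, where Borell's lemma does not apply.
  have htail (k : ℕ) : μ {x | k * s < N x} ≤ 2 * 2⁻¹ ^ ((k : ℝ) / 2) := by
    have h2 : (2 * 2⁻¹ : ℝ≥0∞) = 1 := ENNReal.mul_inv_cancel (by simp) (by simp)
    have h3 (y z : ℝ) (hyz : z ≤ y) : (2⁻¹ : ℝ≥0∞) ^ y ≤ 2⁻¹ ^ z :=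
      ENNReal.rpow_le_rpow_of_exponent_ge (by simp) hyz
    rcases le_or_gt k 1 with hk | hk
    · refine prob_le_one.trans ?_
      rw [← h2]
      gcongr
      have hk' : (k : ℝ) ≤ 1 := by exact_mod_cast hk
      simpa using h3 1 ((k : ℝ) / 2) (by linarith)
    · refine (hμ.measure_seminorm_gt_le N hs hNs (r := k) (by exact_mod_cast hk)).trans ?_
      refine (h3 _ _ (by linarith)).trans (le_mul_of_one_le_left' ?_)
      norm_num
  -- Discrete layer cake: the first `m` odd numbers sum to `m²`, used with `m = ⌈N x / s⌉`.
  have hpt (x) : ENNReal.ofReal (N x ^ 2) ≤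
      ∑' k : ℕ, {x | k * s < N x}.indicator (fun _ => ENNReal.ofReal ((2 * k + 1) * s ^ 2)) x := by
    refine le_trans ?_ (ENNReal.sum_le_tsum (Finset.range ⌈N x / s⌉₊))
    have h1 : ∀ k ∈ Finset.range ⌈N x / s⌉₊,
        {x | k * s < N x}.indicator (fun _ => ENNReal.ofReal ((2 * k + 1) * s ^ 2)) x =
          ENNReal.ofReal ((2 * k + 1) * s ^ 2) := by
      intro k hk
      rw [Finset.mem_range, Nat.lt_ceil, lt_div_iff₀ hs] at hk
      exact Set.indicator_of_mem (s := {x | k * s < N x}) hk _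
    rw [Finset.sum_congr rfl h1, ← ENNReal.ofReal_sum_of_nonneg fun k _ => by positivity]
    refine ENNReal.ofReal_le_ofReal ?_
    have h2 (m : ℕ) : ∑ k ∈ Finset.range m, (2 * (k : ℝ) + 1) * s ^ 2 = (m * s) ^ 2 := by
      induction m with
      | zero => simp
      | succ m ih => rw [Finset.sum_range_succ, ih]; push_cast; ring
    rw [h2]
    exact pow_le_pow_left₀ (apply_nonneg N x) ((div_le_iff₀ hs).1 (Nat.le_ceil _)) 2
  calc ∫⁻ x, ENNReal.ofReal (N x ^ 2) ∂μ
      ≤ ∫⁻ x, ∑' k : ℕ, {x | k * s < N x}.indicator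
          (fun _ => ENNReal.ofReal ((2 * k + 1) * s ^ 2)) x ∂μ := lintegral_mono hpt
    _ = ∑' k : ℕ, ENNReal.ofReal ((2 * k + 1) * s ^ 2) * μ {x | k * s < N x} := by
        rw [lintegral_tsum fun k => (measurable_const.indicator (hmeas k)).aemeasurable]
        simp_rw [lintegral_indicator_const (hmeas _)]
    _ ≤ ∑' k : ℕ, ENNReal.ofReal (s ^ 2) *
          (ENNReal.ofReal (2 * k + 1) * (2 * 2⁻¹ ^ ((k : ℝ) / 2))) := by
        refine ENNReal.tsum_le_tsum fun k => ?_
        rw [ENNReal.ofReal_mul (by positivity), mul_comm (ENNReal.ofReal _) (ENNReal.ofReal _),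
          mul_assoc]
        gcongr
        exact htail k
    _ ≤ ENNReal.ofReal (C * s ^ 2) := by
        rw [ENNReal.tsum_mul_left, mul_comm C, ENNReal.ofReal_mul (by positivity)]
        gcongr

/-- No integrability is assumed: `N` is finite everywhere, so some integer level has tail below
`1/3`, and the quantile bound applies there. -/
theorem IsLogConcave.memLp_seminorm {n : ℕ} {μ : Measure (EuclideanSpace ℝ (Fin n))}
    [IsProbabilityMeasure μ] (hμ : IsLogConcave μ) (N : Seminorm ℝ (EuclideanSpace ℝ (Fin n))) :
    MemLp N 2 μ := by
  obtain ⟨C, -, hC⟩ := exists_lintegral_seminorm_sq_le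
  have hN : Measurable N := N.continuous_euclidean.measurable
  have hlim : Tendsto (fun k : ℕ => μ {x | (k : ℝ) < N x}) atTop (𝓝 0) := by
    have h := tendsto_measure_iInter_atTop (μ := μ) (s := fun k : ℕ => {x | (k : ℝ) < N x})
      (fun k => (measurableSet_lt measurable_const hN).nullMeasurableSet)
      (fun i j hij x (hx : (j : ℝ) < N x) =>
        (lt_of_le_of_lt (by exact_mod_cast hij) hx : (i : ℝ) < N x)) ⟨0, measure_ne_top _ _⟩
    have h0 : ⋂ k : ℕ, {x | (k : ℝ) < N x} = ∅ := by
      ext x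
      simp only [Set.mem_iInter, Set.mem_ofPred_eq, Set.mem_empty_iff_false, iff_false, not_forall,
        not_lt]
      exact exists_nat_ge (N x)
    rwa [h0, measure_empty] at h
  obtain ⟨k, hk, hk0⟩ := ((hlim.eventually (gt_mem_nhds (by simp : (0 : ℝ≥0∞) < 3⁻¹))).and
    (eventually_gt_atTop 0)).exists
  have h := hC hμ N (s := k) (by exact_mod_cast hk0) hk.le
  refine (memLp_two_iff_integrable_sq hN.aestronglyMeasurable).2
    ⟨(hN.pow_const 2).aestronglyMeasurable, ?_⟩
  rw [hasFiniteIntegral_iff_ofReal (ae_of_all _ fun x => sq_nonneg _)]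
  exact h.trans_lt ENNReal.ofReal_lt_top

/-- Reverse Hölder inequality for seminorms under log-concave probability measures. -/
theorem exists_integral_seminorm_sq_le : ∃ C : ℝ, 0 < C ∧
    ∀ {n : ℕ} {μ : Measure (EuclideanSpace ℝ (Fin n))} [IsProbabilityMeasure μ],
      IsLogConcave μ → ∀ (N : Seminorm ℝ (EuclideanSpace ℝ (Fin n))), 0 < ∫ x, N x ∂μ →
        ∫ x, N x ^ 2 ∂μ ≤ (C * ∫ x, N x ∂μ) ^ 2 := by
  obtain ⟨C, hC0, hC⟩ := exists_lintegral_seminorm_sq_le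
  -- The `3` is Markov's inequality: the level `3 * m` is exceeded with probability at most `1/3`.
  refine ⟨√C * 3, by positivity, fun {n μ} _ hμ N hpos => ?_⟩
  have hL := hμ.memLp_seminorm N
  have hint : Integrable N μ := hL.integrable (by norm_num)
  set m := ∫ x, N x ∂μ
  have hmarkov : μ {x | 3 * m < N x} ≤ 3⁻¹ := by
    have h := mul_meas_ge_le_integral_of_nonneg (μ := μ) (ae_of_all _ fun x => apply_nonneg N x)
      hint (3 * m)
    have h1 : μ.real {x | 3 * m < N x} ≤ μ.real {x | 3 * m ≤ N x} :=
      measureReal_mono fun x (hx : 3 * m < N x) => hx.le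
    have h2 : μ.real {x | 3 * m < N x} ≤ 3⁻¹ := by
      have h3 : 3 * m * μ.real {x | 3 * m < N x} ≤ m :=
        (mul_le_mul_of_nonneg_left h1 (by positivity)).trans h
      by_contra! hlt
      nlinarith
    rw [← ofReal_measureReal, show (3⁻¹ : ℝ≥0∞) = ENNReal.ofReal 3⁻¹ by
      rw [ENNReal.ofReal_inv_of_pos (by norm_num)]; simp]
    exact ENNReal.ofReal_le_ofReal h2
  have h := hC hμ N (s := 3 * m) (by positivity) hmarkov
  rw [← ofReal_integral_eq_lintegral_ofReal hL.integrable_sq (ae_of_all _ fun x => sq_nonneg _),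
    ENNReal.ofReal_le_ofReal_iff (by positivity)] at h
  refine h.trans (le_of_eq ?_)
  rw [mul_assoc, mul_pow (√C), Real.sq_sqrt hC0.le]

/-! ### Exponential concentration from the Cheeger constant -/

/-- A differential inequality for antitone functions, which need not be continuous. -/
theorem Antitone.le_mul_exp_neg {φ : ℝ → ℝ} (hφ : Antitone φ) (h0 : ∀ s, 0 ≤ φ s) {h : ℝ}
    (hstep : ∀ s, 0 ≤ s → ∀ᶠ ε in 𝓝[>] (0 : ℝ), φ (s + ε) ≤ φ s * (1 - h * ε)) {T : ℝ}
    (hT : 0 ≤ T) : φ T ≤ φ 0 * Real.exp (-(h * T)) := by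
  set S : Set ℝ := {s | s ∈ Set.Icc 0 T ∧ φ s ≤ φ 0 * Real.exp (-(h * s))} with hS
  have hS0 : (0 : ℝ) ∈ S := ⟨⟨le_rfl, hT⟩, by simp⟩
  have hbdd : BddAbove S := ⟨T, fun s hs => hs.1.2⟩
  have hσT : sSup S ≤ T := csSup_le ⟨0, hS0⟩ fun s hs => hs.1.2
  have hσ0 : 0 ≤ sSup S := le_csSup hbdd hS0
  -- Monotonicity replaces continuity: `φ` at the supremum is at most its value at each point of
  -- `S`, and only the exponential has to pass to the limit.
  have hσ : φ (sSup S) ≤ φ 0 * Real.exp (-(h * sSup S)) := by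
    obtain ⟨u, -, hu, huS⟩ := exists_seq_tendsto_sSup ⟨0, hS0⟩ hbdd
    refine ge_of_tendsto' (x := atTop) (f := fun k => φ 0 * Real.exp (-(h * u k))) ?_ fun k =>
      (hφ (le_csSup hbdd (huS k))).trans (huS k).2
    exact ((Real.continuous_exp.tendsto _).comp (hu.const_mul h).neg).const_mul _
  rcases hσT.eq_or_lt with heq | hlt
  · rwa [heq] at hσ
  have hT' : ∀ᶠ ε in 𝓝[>] (0 : ℝ), ε < T - sSup S :=
    nhdsWithin_le_nhds (gt_mem_nhds (sub_pos.2 hlt))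
  obtain ⟨ε, ⟨hε, hεT⟩, hε0⟩ := (((hstep _ hσ0).and hT').and self_mem_nhdsWithin).exists
  have hε0 : 0 < ε := hε0
  have hmem : sSup S + ε ∈ S := by
    refine ⟨⟨by linarith, by linarith⟩, ?_⟩
    calc φ (sSup S + ε) ≤ φ (sSup S) * (1 - h * ε) := hε
      _ ≤ φ (sSup S) * Real.exp (-(h * ε)) := by
          refine mul_le_mul_of_nonneg_left ?_ (h0 _)
          have := Real.add_one_le_exp (-(h * ε))
          linarith
      _ ≤ φ 0 * Real.exp (-(h * sSup S)) * Real.exp (-(h * ε)) := by gcongr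
      _ = φ 0 * Real.exp (-(h * (sSup S + ε))) := by
          rw [mul_assoc, ← Real.exp_add]; ring_nf
  linarith [le_csSup hbdd hmem]

/-- The median is the infimum of the points where the distribution function reaches `1/2`. Right
continuity there gives one bound, the left limit gives the other. -/
theorem exists_median {α : Type*} [MeasurableSpace α] (P : Measure α) [IsProbabilityMeasure P]
    {g : α → ℝ} (hg : Measurable g) :
    ∃ m, P.real {x | m < g x} ≤ 1 / 2 ∧ P.real {x | g x < m} ≤ 1 / 2 := by
  have := Measure.isProbabilityMeasure_map (μ := P) hg.aemeasurable
  set G := ProbabilityTheory.cdf (P.map g) with hG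
  set S := {a | 1 / 2 ≤ G a} with hS
  obtain ⟨a₀, ha₀⟩ : S.Nonempty :=
    ((ProbabilityTheory.tendsto_cdf_atTop (P.map g)).eventually
      (le_mem_nhds (by norm_num : (1 / 2 : ℝ) < 1))).exists
  obtain ⟨b₀, hb₀⟩ := ((ProbabilityTheory.tendsto_cdf_atBot (P.map g)).eventually
      (gt_mem_nhds (by norm_num : (0 : ℝ) < 1 / 2))).exists
  have hbdd : BddBelow S := by
    refine ⟨b₀, fun a (ha : 1 / 2 ≤ G a) => ?_⟩
    by_contra! hlt
    exact absurd (G.mono hlt.le) (not_le.2 (hb₀.trans_le ha))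
  have hGm : 1 / 2 ≤ G (sInf S) := by
    refine ge_of_tendsto ((G.right_continuous (sInf S)).tendsto.mono_left
      (nhdsWithin_mono _ Set.Ioi_subset_Ici_self)) ?_
    filter_upwards [self_mem_nhdsWithin] with a ha
    obtain ⟨s, hs, hsa⟩ := exists_lt_of_csInf_lt ⟨a₀, ha₀⟩ ha
    exact le_trans hs (G.mono hsa.le)
  refine ⟨sInf S, ?_, ?_⟩
  · have h1 : G (sInf S) = P.real {x | g x ≤ sInf S} := by
      rw [hG, ProbabilityTheory.cdf_eq_real, map_measureReal_apply hg measurableSet_Iic]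
      rfl
    have h2 : P.real {x | g x ≤ sInf S} = 1 - P.real {x | sInf S < g x} := by
      rw [← probReal_compl_eq_one_sub (measurableSet_lt measurable_const hg)]
      congr 1; ext x; simp
    linarith
  · have h1 : P {x | g x < sInf S} = ENNReal.ofReal (Function.leftLim G (sInf S) - 0) := by
      rw [← StieltjesFunction.measure_Iio G (ProbabilityTheory.tendsto_cdf_atBot (P.map g)),
        ProbabilityTheory.measure_cdf, Measure.map_apply hg measurableSet_Iio]
      rfl
    have h2 : Function.leftLim G (sInf S) ≤ 1 / 2 := by
      refine le_of_tendsto (G.mono.tendsto_leftLim (sInf S)) ?_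
      filter_upwards [self_mem_nhdsWithin] with a ha
      by_contra! hlt
      exact absurd (csInf_le hbdd (hlt.le : a ∈ S)) (not_le.2 ha)
    rw [measureReal_def, h1, sub_zero]
    exact (ENNReal.toReal_mono ENNReal.ofReal_ne_top (ENNReal.ofReal_le_ofReal h2)).trans
      (by rw [ENNReal.toReal_ofReal (by norm_num)])

section Concentration

variable {n : ℕ} {ν : Measure (EuclideanSpace ℝ (Fin n))} [IsProbabilityMeasure ν]
  {f : EuclideanSpace ℝ (Fin n) → ℝ} {h m : ℝ}

/-- Isoperimetry is applied to `{f ≤ m}`, whose complement is the smaller side and whose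
`ε`-neighbourhood lies in `{f ≤ m + ε}`. The strict inequality `h' < h` turns a bound on a liminf
into one valid for all small `ε`. -/
theorem eventually_measureReal_gt_add_le (hν : ENNReal.ofReal h ≤ cheegerConstant ν)
    (hf : LipschitzWith 1 f) (hm : ν.real {x | m < f x} ≤ 1 / 2) {h' : ℝ}
    (hh' : 0 ≤ h') (hlt : h' < h) :
    ∀ᶠ ε in 𝓝[>] (0 : ℝ), ν.real {x | m + ε < f x} ≤ ν.real {x | m < f x} * (1 - h' * ε) := by
  have hfm : Measurable f := hf.continuous.measurable
  have hmono (ε : ℝ) (hε : 0 < ε) : ν.real {x | m + ε < f x} ≤ ν.real {x | m < f x} :=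
    measureReal_mono fun x (hx : m + ε < f x) => (by linarith : m < f x)
  have hcompl (a : ℝ) : ν.real {x | f x ≤ a} = 1 - ν.real {x | a < f x} := by
    rw [← probReal_compl_eq_one_sub (measurableSet_lt measurable_const hfm)]
    congr 1; ext x; simp
  rcases (measureReal_nonneg (μ := ν) (s := {x | m < f x})).eq_or_lt with h0 | h0
  · filter_upwards [self_mem_nhdsWithin] with ε hε
    rw [← h0, zero_mul, h0]
    exact hmono ε hε
  set p := ν.real {x | m < f x} with hp
  set A := {x | f x ≤ m} with hA
  have hAm : MeasurableSet A := measurableSet_le hfm measurable_const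
  have hAp : ν A = ENNReal.ofReal (1 - p) := by rw [← ofReal_measureReal, hcompl]
  have hAc : 1 - ν A = ENNReal.ofReal p := by
    rw [hAp, ← ENNReal.ofReal_one, ← ENNReal.ofReal_sub _ (by linarith)]; simp
  have hmin : min (ν A) (1 - ν A) = ENNReal.ofReal p := by
    rw [hAc, hAp]; exact min_eq_right (ENNReal.ofReal_le_ofReal (by linarith))
  have hch : ENNReal.ofReal h ≤ boundaryMeasure ν A / ENNReal.ofReal p := by
    rw [← hmin]
    refine hν.trans (iInf_le_of_le A (iInf_le_of_le hAm (iInf_le_of_le ?_ (iInf_le _ ?_))))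
    · rw [hAp]; exact ENNReal.ofReal_pos.2 (by linarith)
    · rw [hAp, ENNReal.ofReal_lt_one]; linarith
  have hbd : ENNReal.ofReal (h' * p) < boundaryMeasure ν A := by
    refine lt_of_lt_of_le ?_ (ENNReal.mul_le_of_le_div hch)
    rw [← ENNReal.ofReal_mul (by linarith)]
    exact (ENNReal.ofReal_lt_ofReal_iff (by nlinarith)).2 (by nlinarith)
  filter_upwards [eventually_lt_of_lt_liminf hbd, self_mem_nhdsWithin] with ε hε hε0
  have hε0 : 0 < ε := hε0
  have hthick : Metric.thickening ε A ⊆ {x | f x ≤ m + ε} := by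
    intro x hx
    obtain ⟨y, hy, hxy⟩ := Metric.mem_thickening_iff.1 hx
    have h1 := hf.dist_le_mul x y
    rw [Real.dist_eq, NNReal.coe_one, one_mul] at h1
    have h2 := le_abs_self (f x - f y)
    have hy : f y ≤ m := hy
    show f x ≤ m + ε
    linarith
  have h3 : ν (Metric.thickening ε A) ≤ ENNReal.ofReal (1 - ν.real {x | m + ε < f x}) := by
    rw [← hcompl, ofReal_measureReal]
    exact measure_mono hthick
  have h4 : ENNReal.ofReal (h' * p * ε) ≤ ENNReal.ofReal (p - ν.real {x | m + ε < f x}) := by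
    rw [ENNReal.ofReal_mul (by positivity)]
    refine (ENNReal.mul_le_of_le_div hε.le).trans ((tsub_le_tsub_right h3 _).trans ?_)
    rw [hAp, ← ENNReal.ofReal_sub _ (by linarith)]
    exact ENNReal.ofReal_le_ofReal (by linarith)
  rw [ENNReal.ofReal_le_ofReal_iff (by linarith [hmono ε hε0])] at h4
  linarith

theorem measureReal_gt_add_le (hν : ENNReal.ofReal h ≤ cheegerConstant ν) (hh : 0 < h)
    (hf : LipschitzWith 1 f) (hm : ν.real {x | m < f x} ≤ 1 / 2) {s : ℝ} (hs : 0 ≤ s) :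
    ν.real {x | m + s < f x} ≤ 1 / 2 * Real.exp (-(h * s)) := by
  have hanti : Antitone fun s => ν.real {x | m + s < f x} := fun s s' hss' =>
    measureReal_mono fun x (hx : m + s' < f x) => (by linarith : m + s < f x)
  -- The infinitesimal decay holds only at rates below `h`, so the tail bound is proved for `h' < h`
  -- and passed to the limit.
  have key : ∀ᶠ h' in 𝓝[<] h, ν.real {x | m + s < f x} ≤ 1 / 2 * Real.exp (-(h' * s)) := by
    filter_upwards [self_mem_nhdsWithin, nhdsWithin_le_nhds (lt_mem_nhds hh)] with h' hlt hpos
    have h1 := hanti.le_mul_exp_neg (fun _ => measureReal_nonneg) (h := h') (T := s)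
      (fun s hs => ?_) hs
    · refine h1.trans ?_
      rw [add_zero]
      gcongr
    · have := eventually_measureReal_gt_add_le (m := m + s) hν hf
        ((measureReal_mono fun x (hx : m + s < f x) => (by linarith : m < f x)).trans hm)
        (le_of_lt hpos) hlt
      simpa only [add_assoc] using this
  refine ge_of_tendsto (Tendsto.mono_left ?_ nhdsWithin_le_nhds) key
  exact (Continuous.tendsto (by fun_prop) h)

theorem measureReal_abs_sub_integral_gt_le (hν : ENNReal.ofReal h ≤ cheegerConstant ν)
    (hh : 0 < h) (hf : LipschitzWith 1 f) (hint : Integrable f ν) (t : ℝ) :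
    ν.real {x | t < |f x - ∫ y, f y ∂ν|} ≤ 2 * Real.exp (-(h * t / 3)) := by
  obtain ⟨m, hm, hm'⟩ := exists_median ν hf.continuous.measurable
  have htail (s : ℝ) (hs : 0 ≤ s) : ν.real {x | s < |f x - m|} ≤ Real.exp (-(h * s)) := by
    have h1 := measureReal_gt_add_le hν hh hf hm hs
    have h2 := measureReal_gt_add_le (f := fun x => -f x) (m := -m) hν hh hf.neg
      (by simpa only [neg_lt_neg_iff] using hm') hs
    have h3 : {x | s < |f x - m|} ⊆ {x | m + s < f x} ∪ {x | -m + s < -f x} := by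
      intro x (hx : s < |f x - m|)
      rcases lt_abs.1 hx with h | h
      · exact Or.inl (show m + s < f x by linarith)
      · exact Or.inr (show -m + s < -f x by linarith)
    linarith [(measureReal_mono h3 (measure_ne_top ν _)).trans (measureReal_union_le _ _)]
  have hint' : Integrable (fun x => f x - m) ν := hint.sub (integrable_const m)
  -- Integrating the tail `exp (-h s)` about the median bounds its distance to the mean.
  have hmean : |∫ y, f y ∂ν - m| ≤ 1 / h := by
    have h1 : ∫ y, f y ∂ν - m = ∫ y, (f y - m) ∂ν := by
      rw [integral_sub hint (integrable_const m)]; simp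
    rw [h1]
    refine abs_integral_le_integral_abs.trans ?_
    rw [← ENNReal.ofReal_le_ofReal_iff (by positivity),
      ofReal_integral_eq_lintegral_ofReal hint'.abs (ae_of_all _ fun x => abs_nonneg _),
      lintegral_eq_lintegral_meas_lt _ (ae_of_all _ fun x => abs_nonneg _)
        hint'.abs.aemeasurable]
    have h2 : ∫⁻ s in Set.Ioi (0 : ℝ), ν {x | s < |f x - m|} ≤
        ∫⁻ s in Set.Ioi (0 : ℝ), ENNReal.ofReal (Real.exp (-h * s)) := by
      refine setLIntegral_mono' measurableSet_Ioi fun s hs => ?_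
      rw [← ofReal_measureReal, neg_mul]
      exact ENNReal.ofReal_le_ofReal (htail s (le_of_lt hs))
    refine h2.trans (le_of_eq ?_)
    rw [← ofReal_integral_eq_lintegral_ofReal
      (integrableOn_exp_mul_Ioi (neg_lt_zero.2 hh) 0) (ae_of_all _ fun x => (Real.exp_pos _).le),
      integral_exp_mul_Ioi (neg_lt_zero.2 hh)]
    simp
  -- For `h * t ≤ 2` the right side is at least `1`, because `e² ≤ 8`. Beyond that, shifting from
  -- median to mean costs `1` in the exponent, and `h * t - 1 ≥ h * t / 3`.
  rcases le_or_gt (h * t) 2 with hht | hht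
  · refine (measureReal_le_one (μ := ν)).trans ?_
    have h2 : Real.exp (-(2 / 3)) ≤ Real.exp (-(h * t / 3)) := Real.exp_le_exp.2 (by linarith)
    have h3 : (1 / 2 : ℝ) ≤ Real.exp (-(2 / 3)) := by
      rw [Real.exp_neg, ← one_div]
      gcongr
      have : Real.exp (2 / 3) ^ 3 ≤ 2 ^ 3 := by
        rw [← Real.exp_nat_mul]
        have := Real.exp_one_lt_d9
        norm_num
        calc Real.exp 2 = Real.exp 1 ^ 2 := by rw [← Real.exp_nat_mul]; norm_num
          _ ≤ 2.7182818286 ^ 2 := by gcongr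
          _ ≤ 8 := by norm_num
      exact le_of_pow_le_pow_left₀ (by norm_num) (by norm_num) this
    linarith
  · have hs : 0 ≤ t - 1 / h := by
      rw [sub_nonneg, div_le_iff₀ hh]; linarith
    have h1 : {x | t < |f x - ∫ y, f y ∂ν|} ⊆ {x | t - 1 / h < |f x - m|} := by
      intro x (hx : t < |f x - ∫ y, f y ∂ν|)
      have := abs_sub_le (f x) m (∫ y, f y ∂ν)
      rw [abs_sub_comm m] at this
      show t - 1 / h < |f x - m|
      linarith
    refine (measureReal_mono h1).trans ((htail _ hs).trans ?_)
    have h2 : h * (t - 1 / h) = h * t - 1 := by field_simp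
    have h3 : Real.exp (-(h * (t - 1 / h))) ≤ Real.exp (-(h * t / 3)) := by
      rw [h2]; exact Real.exp_le_exp.2 (by linarith)
    linarith [Real.exp_pos (-(h * t / 3))]

end Concentration

/-! ### Brunn–Minkowski and Prékopa–Leindler on the line -/

/-- One-dimensional Brunn–Minkowski inequality for compact sets. -/
theorem IsCompact.volume_add_volume_le {K L : Set ℝ} (hK : IsCompact K) (hL : IsCompact L)
    (hK0 : K.Nonempty) (hL0 : L.Nonempty) : volume K + volume L ≤ volume (K + L) := by
  obtain ⟨x, hx, hxK⟩ := hK.exists_isGreatest hK0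
  obtain ⟨y, hy, hyL⟩ := hL.exists_isLeast hL0
  -- With `x = max K` and `y = min L`, the translates `K + y` and `x + L` can meet only at `x + y`.
  have hsub : (fun z => z + y) '' K ∪ (fun z => x + z) '' L ⊆ K + L := by
    rintro _ (⟨z, hz, rfl⟩ | ⟨z, hz, rfl⟩)
    · exact Set.add_mem_add hz hy
    · exact Set.add_mem_add hx hz
  have hdisj : AEDisjoint volume ((fun z => z + y) '' K) ((fun z => x + z) '' L) := by
    refine measure_mono_null (t := {x + y}) ?_ (by simp)
    rintro _ ⟨⟨z, hz, rfl⟩, ⟨w, hw, hzw⟩⟩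
    have h1 := hxK hz
    have h2 := hyL hw
    have h3 : x + w = z + y := hzw
    show z + y = x + y
    linarith
  have hm : MeasurableSet ((fun z => x + z) '' L) :=
    (hL.image (by fun_prop)).measurableSet
  calc volume K + volume L
      = volume ((fun z => z + y) '' K) + volume ((fun z => x + z) '' L) := by
        rw [Set.image_add_right, Set.image_add_left, measure_preimage_add_right,
          measure_preimage_add]
    _ = volume ((fun z => z + y) '' K ∪ (fun z => x + z) '' L) :=
        (measure_union₀ hm.nullMeasurableSet hdisj).symm
    _ ≤ _ := measure_mono hsub

/-- One-dimensional Brunn–Minkowski inequality for measurable sets. -/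
theorem mul_volume_add_mul_volume_le {A B C : Set ℝ} (hA : MeasurableSet A)
    (hB : MeasurableSet B) (hA0 : A.Nonempty) (hB0 : B.Nonempty) {a b : ℝ} (ha : 0 < a)
    (hb : 0 < b) (hC : a • A + b • B ⊆ C) :
    ENNReal.ofReal a * volume A + ENNReal.ofReal b * volume B ≤ volume C := by
  have key (K : Set ℝ) (hK : IsCompact K) (hKA : K ⊆ A) (L : Set ℝ) (hL : IsCompact L)
      (hLB : L ⊆ B) : ENNReal.ofReal a * volume K + ENNReal.ofReal b * volume L ≤ volume C := by
    obtain ⟨x, hx⟩ := hA0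
    obtain ⟨y, hy⟩ := hB0
    -- The approximating compact sets may be empty, so a point of `A` and one of `B` are adjoined.
    have h := ((hK.insert x).smul a).volume_add_volume_le ((hL.insert y).smul b)
      ((Set.insert_nonempty _ _).smul_set) ((Set.insert_nonempty _ _).smul_set)
    simp only [Measure.addHaar_smul, Module.finrank_self, pow_one, abs_of_pos ha,
      abs_of_pos hb] at h
    calc _ ≤ ENNReal.ofReal a * volume (insert x K) + ENNReal.ofReal b * volume (insert y L) := by
          gcongr <;> exact Set.subset_insert _ _
      _ ≤ _ := h
      _ ≤ volume C := measure_mono ((Set.add_subset_add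
          (Set.smul_set_mono (Set.insert_subset hx hKA))
          (Set.smul_set_mono (Set.insert_subset hy hLB))).trans hC)
  rw [hA.measure_eq_iSup_isCompact, hB.measure_eq_iSup_isCompact]
  simp only [ENNReal.mul_iSup, iSup_and']
  exact ENNReal.biSup_add_biSup_le' ⟨∅, by simp⟩ ⟨∅, by simp⟩ fun K hK L hL =>
    key K hK.2 hK.1 L hL.2 hL.1

theorem ENNReal.rpow_mul_rpow_le_add (x y : ℝ≥0∞) {a b : ℝ} (ha : 0 < a) (hb : 0 < b)
    (hab : a + b = 1) : x ^ a * y ^ b ≤ ENNReal.ofReal a * x + ENNReal.ofReal b * y := by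
  rcases eq_or_ne x ∞ with rfl | hx
  · rw [ENNReal.mul_top (by simpa using ha)]; simp
  rcases eq_or_ne y ∞ with rfl | hy
  · rw [ENNReal.mul_top (by simpa using hb)]; simp
  have h := Real.geom_mean_le_arith_mean2_weighted ha.le hb.le (x.toReal_nonneg)
    (y.toReal_nonneg) hab
  rw [← ENNReal.ofReal_toReal hx, ← ENNReal.ofReal_toReal hy,
    ENNReal.ofReal_rpow_of_nonneg ENNReal.toReal_nonneg ha.le,
    ENNReal.ofReal_rpow_of_nonneg ENNReal.toReal_nonneg hb.le,
    ← ENNReal.ofReal_mul (by positivity), ← ENNReal.ofReal_mul ha.le, ← ENNReal.ofReal_mul hb.le,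
    ← ENNReal.ofReal_add (by positivity) (by positivity)]
  exact ENNReal.ofReal_le_ofReal h

theorem lintegral_ofReal_eq_setLIntegral_Ioo {f : ℝ → ℝ} (hf : Measurable f) (hf0 : ∀ s, 0 ≤ f s)
    (hf1 : ∀ s, f s ≤ 1) :
    ∫⁻ s, ENNReal.ofReal (f s) = ∫⁻ t in Set.Ioo 0 1, volume {s | t < f s} := by
  rw [lintegral_eq_lintegral_meas_lt _ (ae_of_all _ hf0) hf.aemeasurable]
  have hU : Set.Ioi (0 : ℝ) = Set.Ioo 0 1 ∪ Set.Ici 1 := (Set.Ioo_union_Ici_eq_Ioi (by simp)).symm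
  rw [hU, lintegral_union measurableSet_Ici
    (Set.disjoint_left.2 fun x hx hx' => absurd hx.2 (not_lt.2 hx'))]
  have h0 : ∫⁻ t in Set.Ici (1 : ℝ), volume {s | t < f s} = 0 := by
    rw [setLIntegral_congr_fun (g := fun _ => 0) measurableSet_Ici fun t (ht : 1 ≤ t) => ?_]
    · simp
    · have : {s | t < f s} = ∅ := by
        ext s; simpa using (hf1 s).trans ht
      simp [this]
  rw [h0, add_zero]

/-- For each `t` in `(0, 1)` the superlevel sets of `f` and `g` are nonempty and their weighted sum
lies in that of `h`. Brunn–Minkowski is applied level by level and integrated in `t`. -/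
theorem add_lintegral_le_of_sup_eq_one {f g h : ℝ → ℝ} (hf : Measurable f) (hg : Measurable g)
    (hh : Measurable h) (hf0 : ∀ s, 0 ≤ f s) (hg0 : ∀ s, 0 ≤ g s) (hh0 : ∀ s, 0 ≤ h s)
    (hf1 : ∀ s, f s ≤ 1) (hg1 : ∀ s, g s ≤ 1) (hfs : ∀ r < 1, ∃ s, r < f s)
    (hgs : ∀ r < 1, ∃ s, r < g s) {a b : ℝ} (ha : 0 < a) (hb : 0 < b) (hab : a + b = 1)
    (hfgh : ∀ s t, f s ^ a * g t ^ b ≤ h (a * s + b * t)) :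
    ENNReal.ofReal a * (∫⁻ s, ENNReal.ofReal (f s)) + ENNReal.ofReal b *
      (∫⁻ s, ENNReal.ofReal (g s)) ≤ ∫⁻ s, ENNReal.ofReal (h s) := by
  have hanti (f : ℝ → ℝ) : Measurable fun t => volume {s | t < f s} :=
    Antitone.measurable fun t t' htt' => measure_mono fun s (hs : t' < f s) => htt'.trans_lt hs
  rw [lintegral_ofReal_eq_setLIntegral_Ioo hf hf0 hf1,
    lintegral_ofReal_eq_setLIntegral_Ioo hg hg0 hg1,
    lintegral_eq_lintegral_meas_lt _ (ae_of_all _ hh0) hh.aemeasurable,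
    ← lintegral_const_mul _ (hanti f), ← lintegral_const_mul _ (hanti g),
    ← lintegral_add_left ((hanti f).const_mul _)]
  refine le_trans ?_ (lintegral_mono_set fun t (ht : t ∈ Set.Ioo (0 : ℝ) 1) => ht.1)
  refine setLIntegral_mono' measurableSet_Ioo fun t ht => ?_
  refine mul_volume_add_mul_volume_le (measurableSet_lt measurable_const hf)
    (measurableSet_lt measurable_const hg) (hfs t ht.2) (hgs t ht.2) ha hb ?_
  rintro _ ⟨_, ⟨x, hx, rfl⟩, _, ⟨y, hy, rfl⟩, rfl⟩
  have hx : t < f x := hx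
  have hy : t < g y := hy
  refine lt_of_lt_of_le (?_ : t < f x ^ a * g y ^ b) (hfgh x y)
  calc t = t ^ a * t ^ b := by rw [← Real.rpow_add ht.1, hab, Real.rpow_one]
    _ < f x ^ a * g y ^ b := by
      have h1 := Real.rpow_lt_rpow ht.1.le hx ha
      have h2 := Real.rpow_lt_rpow ht.1.le hy hb
      exact mul_lt_mul'' h1 h2 (Real.rpow_nonneg ht.1.le _) (Real.rpow_nonneg ht.1.le _)

/-- One-dimensional Prékopa–Leindler inequality for bounded functions. -/
theorem lintegral_rpow_mul_lintegral_rpow_le {f g h : ℝ → ℝ} (hf : Measurable f)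
    (hg : Measurable g) (hh : Measurable h) (hf0 : ∀ s, 0 ≤ f s) (hg0 : ∀ s, 0 ≤ g s)
    (hh0 : ∀ s, 0 ≤ h s) (hfb : BddAbove (Set.range f)) (hgb : BddAbove (Set.range g))
    {a b : ℝ} (ha : 0 < a) (hb : 0 < b) (hab : a + b = 1)
    (hfgh : ∀ s t, f s ^ a * g t ^ b ≤ h (a * s + b * t)) :
    (∫⁻ s, ENNReal.ofReal (f s)) ^ a * (∫⁻ s, ENNReal.ofReal (g s)) ^ b ≤
      ∫⁻ s, ENNReal.ofReal (h s) := by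
  have hzero (f : ℝ → ℝ) (hf0 : ∀ s, 0 ≤ f s) (hfb : BddAbove (Set.range f))
      (h : ¬ 0 < ⨆ s, f s) : ∫⁻ s, ENNReal.ofReal (f s) = 0 := by
    have : ∀ s, f s = 0 := fun s => le_antisymm ((le_ciSup hfb s).trans (not_lt.1 h)) (hf0 s)
    simp [this]
  have hscale (f : ℝ → ℝ) (hf : Measurable f) (M : ℝ) (hM : 0 < M) :
      ∫⁻ s, ENNReal.ofReal (f s) = ENNReal.ofReal M * ∫⁻ s, ENNReal.ofReal (M⁻¹ * f s) := by
    rw [← lintegral_const_mul _ (by fun_prop)]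
    refine lintegral_congr fun s => ?_
    rw [← ENNReal.ofReal_mul hM.le, mul_inv_cancel_left₀ hM.ne']
  by_cases hMf : 0 < ⨆ s, f s
  swap
  · rw [hzero f hf0 hfb hMf, ENNReal.zero_rpow_of_pos ha, zero_mul]; exact zero_le
  by_cases hMg : 0 < ⨆ s, g s
  swap
  · rw [hzero g hg0 hgb hMg, ENNReal.zero_rpow_of_pos hb, mul_zero]; exact zero_le
  set F := ⨆ s, f s with hF
  set G := ⨆ s, g s with hG
  have hH : 0 < F ^ a * G ^ b := by positivity
  have hsup (f : ℝ → ℝ) (hM : 0 < ⨆ s, f s) :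
      ∀ r < 1, ∃ s, r < (⨆ s, f s)⁻¹ * f s := by
    intro r hr
    obtain ⟨s, hs⟩ := exists_lt_of_lt_ciSup (show r * (⨆ s, f s) < ⨆ s, f s by nlinarith)
    exact ⟨s, by rw [inv_mul_eq_div, lt_div_iff₀ hM]; exact hs⟩
  -- Dividing `f`, `g`, `h` by `F`, `G`, `F ^ a * G ^ b` preserves the hypothesis and normalises the
  -- suprema to `1`; the weighted AM–GM inequality then yields the product form.
  have key := add_lintegral_le_of_sup_eq_one (f := fun s => F⁻¹ * f s) (g := fun s => G⁻¹ * g s)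
    (h := fun s => (F ^ a * G ^ b)⁻¹ * h s) (by fun_prop) (by fun_prop) (by fun_prop)
    (fun s => mul_nonneg (by positivity) (hf0 s)) (fun s => mul_nonneg (by positivity) (hg0 s))
    (fun s => mul_nonneg (by positivity) (hh0 s))
    (fun s => by rw [inv_mul_le_iff₀ hMf, mul_one]; exact le_ciSup hfb s)
    (fun s => by rw [inv_mul_le_iff₀ hMg, mul_one]; exact le_ciSup hgb s)
    (hsup f hMf) (hsup g hMg) ha hb hab (fun s t => by
      rw [Real.mul_rpow (by positivity) (hf0 s), Real.mul_rpow (by positivity) (hg0 t),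
        Real.inv_rpow hMf.le, Real.inv_rpow hMg.le, mul_mul_mul_comm, ← mul_inv]
      exact mul_le_mul_of_nonneg_left (hfgh s t) (by positivity))
  rw [hscale f hf F hMf, hscale g hg G hMg, hscale h hh _ hH,
    ENNReal.mul_rpow_of_nonneg _ _ ha.le, ENNReal.mul_rpow_of_nonneg _ _ hb.le,
    mul_mul_mul_comm, ENNReal.ofReal_rpow_of_pos hMf, ENNReal.ofReal_rpow_of_pos hMg,
    ← ENNReal.ofReal_mul (by positivity)]
  gcongr
  exact (ENNReal.rpow_mul_rpow_le_add _ _ ha hb hab).trans key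

/-! ### Adding an independent uniform variable along a direction -/

/-- The uniform distribution on `[-√3, √3]`, which is centered with unit variance. -/
noncomputable def stdUniform : Measure ℝ :=
  ENNReal.ofReal (2 * √3)⁻¹ • volume.restrict (Set.Icc (-√3) √3)

theorem integral_stdUniform (f : ℝ → ℝ) :
    ∫ u, f u ∂stdUniform = (2 * √3)⁻¹ * ∫ u in (-√3)..√3, f u := by
  rw [stdUniform, integral_smul_measure, ENNReal.toReal_ofReal (by positivity),
    integral_Icc_eq_integral_Ioc, intervalIntegral.integral_of_le (by linarith [Real.sqrt_nonneg 3]),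
    smul_eq_mul]

instance : IsProbabilityMeasure stdUniform := by
  constructor
  rw [stdUniform, Measure.smul_apply, Measure.restrict_apply_univ, Real.volume_Icc, smul_eq_mul,
    ← ENNReal.ofReal_mul (by positivity), sub_neg_eq_add, ← two_mul,
    inv_mul_cancel₀ (by positivity), ENNReal.ofReal_one]

theorem integral_id_stdUniform : ∫ u, u ∂stdUniform = 0 := by
  rw [integral_stdUniform, integral_id]; simp

theorem integral_sq_stdUniform : ∫ u, u ^ 2 ∂stdUniform = 1 := by
  rw [integral_stdUniform, integral_pow]
  have h : √3 ^ 2 = 3 := Real.sq_sqrt (by norm_num)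
  have h0 : √3 ≠ 0 := by positivity
  field_simp
  push_cast
  linear_combination (2 * √3) * h

theorem memLp_id_stdUniform : MemLp (fun u : ℝ => u) 2 stdUniform := by
  refine MemLp.of_bound (C := √3) (by fun_prop) ?_
  rw [stdUniform]
  refine Measure.ae_smul_measure ?_ _
  filter_upwards [ae_restrict_mem measurableSet_Icc] with u hu
  exact abs_le.2 hu

section Smear

variable {n : ℕ}

/-- The law of `X + U • e`, where `X` has law `μ` and `U` is an independent standard uniform
variable. -/
noncomputable def uniformSmear (μ : Measure (EuclideanSpace ℝ (Fin n)))
    (e : EuclideanSpace ℝ (Fin n)) : Measure (EuclideanSpace ℝ (Fin n)) :=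
  (μ.prod stdUniform).map fun p => p.1 + p.2 • e

instance (μ : Measure (EuclideanSpace ℝ (Fin n))) [IsProbabilityMeasure μ]
    (e : EuclideanSpace ℝ (Fin n)) : IsProbabilityMeasure (uniformSmear μ e) :=
  Measure.isProbabilityMeasure_map (by fun_prop)

theorem measurable_measureReal_add_smul_mem (μ : Measure (EuclideanSpace ℝ (Fin n)))
    [IsProbabilityMeasure μ] (e : EuclideanSpace ℝ (Fin n))
    {A : Set (EuclideanSpace ℝ (Fin n))} (hA : MeasurableSet A) :
    Measurable fun u : ℝ => μ.real {x | x + u • e ∈ A} := by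
  have h : Measurable fun p : EuclideanSpace ℝ (Fin n) × ℝ => p.1 + p.2 • e := by fun_prop
  exact (measurable_measure_prodMk_right (h hA)).ennreal_toReal

theorem uniformSmear_apply (μ : Measure (EuclideanSpace ℝ (Fin n))) [IsProbabilityMeasure μ]
    (e : EuclideanSpace ℝ (Fin n)) {A : Set (EuclideanSpace ℝ (Fin n))} (hA : MeasurableSet A) :
    uniformSmear μ e A = ENNReal.ofReal (2 * √3)⁻¹ * ∫⁻ u, ENNReal.ofReal
      ((Set.Icc (-√3) √3).indicator (fun u => μ.real {x | x + u • e ∈ A}) u) := by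
  have h : Measurable fun p : EuclideanSpace ℝ (Fin n) × ℝ => p.1 + p.2 • e := by fun_prop
  rw [uniformSmear, Measure.map_apply h hA, Measure.prod_apply_symm (h hA), stdUniform,
    lintegral_smul_measure, smul_eq_mul, ← lintegral_indicator measurableSet_Icc]
  congr 1
  refine lintegral_congr fun u => ?_
  by_cases hu : u ∈ Set.Icc (-√3) √3
  · rw [Set.indicator_of_mem hu, Set.indicator_of_mem hu, ofReal_measureReal]
    rfl
  · rw [Set.indicator_of_notMem hu, Set.indicator_of_notMem hu, ENNReal.ofReal_zero]

/-- The smeared mass of a set integrates over `u` its `μ`-mass after translation by `-u • e`.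
Log-concavity of `μ` and convexity of the interval give the Prékopa–Leindler hypothesis in the
single variable `u`. -/
theorem IsLogConcave.smear {μ : Measure (EuclideanSpace ℝ (Fin n))}
    [IsProbabilityMeasure μ] (hμ : IsLogConcave μ) (e : EuclideanSpace ℝ (Fin n)) :
    IsLogConcave (uniformSmear μ e) := by
  intro A B hA hB a b ha hb hab
  have hC := ((hA.smul a).add (hB.smul b)).measurableSet
  rw [uniformSmear_apply μ e hA.measurableSet, uniformSmear_apply μ e hB.measurableSet,
    uniformSmear_apply μ e hC, ENNReal.mul_rpow_of_nonneg _ _ ha.le,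
    ENNReal.mul_rpow_of_nonneg _ _ hb.le, mul_mul_mul_comm,
    ← ENNReal.rpow_add _ _ (ENNReal.ofReal_pos.2 (by positivity)).ne' ENNReal.ofReal_ne_top, hab,
    ENNReal.rpow_one]
  gcongr
  have hmeas {D : Set (EuclideanSpace ℝ (Fin n))} (hD : MeasurableSet D) :
      Measurable ((Set.Icc (-√3) √3).indicator fun u => μ.real {x | x + u • e ∈ D}) :=
    (measurable_measureReal_add_smul_mem μ e hD).indicator measurableSet_Icc
  have hnn (D : Set (EuclideanSpace ℝ (Fin n))) (u : ℝ) :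
      0 ≤ (Set.Icc (-√3) √3).indicator (fun u => μ.real {x | x + u • e ∈ D}) u :=
    Set.indicator_nonneg (fun _ _ => measureReal_nonneg) u
  have hbdd (D : Set (EuclideanSpace ℝ (Fin n))) :
      BddAbove (Set.range
        ((Set.Icc (-√3) √3).indicator fun u => μ.real {x | x + u • e ∈ D})) := by
    refine ⟨1, ?_⟩
    rintro _ ⟨u, rfl⟩
    exact Set.indicator_apply_le' (fun _ => measureReal_le_one) fun _ => zero_le_one
  refine lintegral_rpow_mul_lintegral_rpow_le (hmeas hA.measurableSet) (hmeas hB.measurableSet)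
    (hmeas hC) (hnn _) (hnn _) (hnn _) (hbdd _) (hbdd _) ha hb hab fun s t => ?_
  by_cases hs : s ∈ Set.Icc (-√3) √3
  swap
  · rw [Set.indicator_of_notMem hs, Real.zero_rpow ha.ne', zero_mul]; exact hnn _ _
  by_cases ht : t ∈ Set.Icc (-√3) √3
  swap
  · rw [Set.indicator_of_notMem ht, Real.zero_rpow hb.ne', mul_zero]; exact hnn _ _
  have hst : a * s + b * t ∈ Set.Icc (-√3) √3 := convex_Icc _ _ hs ht ha.le hb.le hab
  rw [Set.indicator_of_mem hs, Set.indicator_of_mem ht, Set.indicator_of_mem hst]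
  have hpre (u : ℝ) {D : Set (EuclideanSpace ℝ (Fin n))} (hD : MeasurableSet D) :
      MeasurableSet {x | x + u • e ∈ D} :=
    (show Measurable fun x => x + u • e by fun_prop) hD
  have key := hμ.rpow_mul_rpow_le (hpre s hA.measurableSet) (hpre t hB.measurableSet) ha hb hab
    (C := {x | x + (a * s + b * t) • e ∈ a • A + b • B}) (by
      rintro _ ⟨_, ⟨x, hx, rfl⟩, _, ⟨y, hy, rfl⟩, rfl⟩
      refine ⟨a • (x + s • e), ⟨_, hx, rfl⟩, b • (y + t • e), ⟨_, hy, rfl⟩, ?_⟩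
      simp only [smul_add, add_smul, mul_smul]
      abel)
  have h := ENNReal.toReal_mono (measure_ne_top _ _) key
  rwa [ENNReal.toReal_mul, ← ENNReal.toReal_rpow, ← ENNReal.toReal_rpow] at h

theorem integral_uniformSmear (μ : Measure (EuclideanSpace ℝ (Fin n)))
    (e : EuclideanSpace ℝ (Fin n)) {g : EuclideanSpace ℝ (Fin n) → ℝ} (hg : Continuous g) :
    ∫ x, g x ∂uniformSmear μ e = ∫ p, g (p.1 + p.2 • e) ∂μ.prod stdUniform :=
  integral_map (by fun_prop) hg.aestronglyMeasurable

section Moments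

variable {μ : Measure (EuclideanSpace ℝ (Fin n))} [IsProbabilityMeasure μ]
  (e θ : EuclideanSpace ℝ (Fin n))

theorem integral_inner_uniformSmear (hμ : MemLp id 2 μ) :
    ∫ x, inner ℝ x θ ∂uniformSmear μ e = ∫ x, inner ℝ x θ ∂μ := by
  have h1 : Integrable (fun x => inner ℝ x θ) μ := (hμ.integrable (by norm_num)).inner_const θ
  have h2 : Integrable (fun u : ℝ => u) stdUniform := memLp_id_stdUniform.integrable (by norm_num)
  rw [integral_uniformSmear μ e (by fun_prop)]
  simp_rw [inner_add_left, real_inner_smul_left]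
  rw [integral_add (h1.comp_fst _) ((h2.comp_snd _).mul_const _), integral_mul_const,
    integral_fun_fst (fun x => inner ℝ x θ), integral_fun_snd (fun u : ℝ => u),
    integral_id_stdUniform]
  simp

/-- The cross term vanishes, so smearing adds the rank-one form of `e` to the covariance. This is
what fills a null direction. -/
theorem integral_inner_sq_uniformSmear (hμ : MemLp id 2 μ) (hμ0 : ∫ x, inner ℝ x θ ∂μ = 0) :
    ∫ x, inner ℝ x θ ^ 2 ∂uniformSmear μ e = ∫ x, inner ℝ x θ ^ 2 ∂μ + inner ℝ e θ ^ 2 := by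
  have h0 : MemLp (fun x => inner ℝ x θ) 2 μ := hμ.inner_const θ
  have h1 : Integrable (fun x => inner ℝ x θ) μ := h0.integrable (by norm_num)
  have h2 : Integrable (fun u : ℝ => u) stdUniform := memLp_id_stdUniform.integrable (by norm_num)
  rw [integral_uniformSmear μ e (by fun_prop)]
  have hexp (p : EuclideanSpace ℝ (Fin n) × ℝ) : inner ℝ (p.1 + p.2 • e) θ ^ 2 =
      inner ℝ p.1 θ ^ 2 + inner ℝ p.1 θ * p.2 * (2 * inner ℝ e θ) + p.2 ^ 2 * inner ℝ e θ ^ 2 := by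
    rw [inner_add_left, real_inner_smul_left]; ring
  simp_rw [hexp]
  have i1 := (h0.integrable_sq).comp_fst stdUniform
  have i2 := (h1.mul_prod h2).mul_const (2 * inner ℝ e θ)
  have i3 := ((memLp_id_stdUniform.integrable_sq).comp_snd μ).mul_const (inner ℝ e θ ^ 2)
  have i12 : Integrable (fun p : EuclideanSpace ℝ (Fin n) × ℝ =>
      inner ℝ p.1 θ ^ 2 + inner ℝ p.1 θ * p.2 * (2 * inner ℝ e θ)) (μ.prod stdUniform) := i1.add i2
  rw [integral_add i12 i3, integral_add i1 i2, integral_mul_const, integral_mul_const,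
    integral_fun_fst (fun x => inner ℝ x θ ^ 2), integral_fun_snd (fun u : ℝ => u ^ 2),
    integral_prod_mul (fun x => inner ℝ x θ) (fun u : ℝ => u), integral_sq_stdUniform, hμ0]
  simp

end Moments

end Smear

/-! ### Diagonal operators and the isotropic lift -/

section Diagonal

variable {n : ℕ} (e : OrthonormalBasis (Fin n) ℝ (EuclideanSpace ℝ (Fin n)))

/-- The operator that is diagonal in the orthonormal basis `e`, with diagonal entries `c`. -/
noncomputable def OrthonormalBasis.diag (c : Fin n → ℝ) :
    EuclideanSpace ℝ (Fin n) →L[ℝ] EuclideanSpace ℝ (Fin n) :=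
  ∑ i, c i • (innerSL ℝ (e i)).smulRight (e i)

theorem OrthonormalBasis.diag_apply (c : Fin n → ℝ) (x : EuclideanSpace ℝ (Fin n)) :
    e.diag c x = ∑ i, c i • inner ℝ (e i) x • e i := by
  simp [OrthonormalBasis.diag]

theorem OrthonormalBasis.inner_diag (c : Fin n → ℝ) (i : Fin n) (x : EuclideanSpace ℝ (Fin n)) :
    inner ℝ (e i) (e.diag c x) = c i * inner ℝ (e i) x := by
  rw [e.diag_apply, inner_sum, Finset.sum_eq_single i]
  · simp [real_inner_smul_right]
  · intro j _ hj
    simp [real_inner_smul_right, e.orthonormal.2 hj.symm]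
  · simp

theorem OrthonormalBasis.diag_diag (c d : Fin n → ℝ) (x : EuclideanSpace ℝ (Fin n)) :
    e.diag c (e.diag d x) = e.diag (c * d) x := by
  rw [e.diag_apply, e.diag_apply (c * d)]
  simp_rw [e.inner_diag, smul_smul, Pi.mul_apply, mul_assoc]

theorem OrthonormalBasis.inner_diag_left (c : Fin n → ℝ) (x y : EuclideanSpace ℝ (Fin n)) :
    inner ℝ (e.diag c x) y = ∑ i, c i * (inner ℝ (e i) x * inner ℝ (e i) y) := by
  simp [e.diag_apply, sum_inner, real_inner_smul_left]

theorem OrthonormalBasis.inner_diag_comm (c : Fin n → ℝ) (x y : EuclideanSpace ℝ (Fin n)) :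
    inner ℝ (e.diag c x) y = inner ℝ x (e.diag c y) := by
  rw [real_inner_comm (e.diag c y) x, e.inner_diag_left, e.inner_diag_left]
  exact Finset.sum_congr rfl fun i _ => by ring

theorem OrthonormalBasis.diag_self (c : Fin n → ℝ) (i : Fin n) : e.diag c (e i) = c i • e i := by
  rw [e.diag_apply, Finset.sum_eq_single i]
  · simp
  · intro j _ hj
    simp [e.orthonormal.2 hj]
  · simp

end Diagonal

section IsotropicLift

variable {n : ℕ}

theorem IsLogConcave.memLp_id {μ : Measure (EuclideanSpace ℝ (Fin n))}
    [IsProbabilityMeasure μ] (hμ : IsLogConcave μ) : MemLp id 2 μ :=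
  (memLp_norm_iff (by fun_prop)).1
    (hμ.memLp_seminorm (normSeminorm ℝ (EuclideanSpace ℝ (Fin n))))

theorem IsLogConcave.memLp_inner {μ : Measure (EuclideanSpace ℝ (Fin n))}
    [IsProbabilityMeasure μ] (hμ : IsLogConcave μ) (θ : EuclideanSpace ℝ (Fin n)) :
    MemLp (fun x => inner ℝ x θ) 2 μ :=
  hμ.memLp_id.inner_const θ

theorem exists_diag_covariance {μ : Measure (EuclideanSpace ℝ (Fin n))} (hμ : MemLp id 2 μ) :
    ∃ (e : OrthonormalBasis (Fin n) ℝ (EuclideanSpace ℝ (Fin n))) (l : Fin n → ℝ),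
      (∀ i, 0 ≤ l i) ∧
      ∀ θ, ∫ x, inner ℝ x θ ^ 2 ∂μ = ∑ i, l i * inner ℝ (e i) θ ^ 2 := by
  have hpos := ProbabilityTheory.isPositive_covarianceOperator (μ := μ)
  set S := ProbabilityTheory.covarianceOperator μ
  have hn : Module.finrank ℝ (EuclideanSpace ℝ (Fin n)) = n := finrank_euclideanSpace_fin
  set e := hpos.isSymmetric.eigenvectorBasis hn with he
  set l := hpos.isSymmetric.eigenvalues hn with hl
  have hcov (θ : EuclideanSpace ℝ (Fin n)) : ∫ x, inner ℝ x θ ^ 2 ∂μ = inner ℝ (S θ) θ := by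
    rw [ProbabilityTheory.covarianceOperator_inner hμ]
    simp_rw [real_inner_comm, sq]
  refine ⟨e, l, fun i => ?_, fun θ => ?_⟩
  · exact hpos.nonneg_eigenvalues hn i
  · rw [hcov]
    have h1 (i : Fin n) : inner ℝ (S θ) (e i) = l i * inner ℝ θ (e i) := by
      have := hpos.isSymmetric θ (e i)
      rw [he, hpos.isSymmetric.apply_eigenvectorBasis hn i] at this
      rw [he]
      refine this.trans ?_
      simp [real_inner_smul_right, hl]
    rw [← e.sum_inner_mul_inner (S θ) θ]
    refine Finset.sum_congr rfl fun i _ => ?_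
    rw [h1, real_inner_comm]; ring

theorem integral_inner_map {μ : Measure (EuclideanSpace ℝ (Fin n))}
    (T : EuclideanSpace ℝ (Fin n) →L[ℝ] EuclideanSpace ℝ (Fin n)) (g : ℝ → ℝ) (hg : Continuous g)
    (θ : EuclideanSpace ℝ (Fin n)) :
    ∫ x, g (inner ℝ x θ) ∂μ.map T = ∫ x, g (inner ℝ (T x) θ) ∂μ :=
  integral_map (by fun_prop) (by fun_prop)

/-- Every centered log-concave probability measure, possibly degenerate, is a linear image of an
isotropic one in the same dimension. -/
theorem IsLogConcave.exists_isotropic_lift {μ : Measure (EuclideanSpace ℝ (Fin n))}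
    [IsProbabilityMeasure μ] (hμ : IsLogConcave μ) (hμ0 : ∀ θ, ∫ x, inner ℝ x θ ∂μ = 0) :
    ∃ ν : Measure (EuclideanSpace ℝ (Fin n)), IsProbabilityMeasure ν ∧ IsIsotropic ν ∧
      IsLogConcave ν ∧ ∃ L : EuclideanSpace ℝ (Fin n) →L[ℝ] EuclideanSpace ℝ (Fin n),
        ν.map L = μ := by
  obtain ⟨e, l, hl, hcov⟩ := exists_diag_covariance hμ.memLp_id
  -- Since `0⁻¹ = 0`, `T` kills the null eigendirections, and `L ∘ T` is the projection onto the
  -- others. It is the identity `μ`-almost everywhere because a null direction carries no second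
  -- moment.
  set T := e.diag fun i => (√(l i))⁻¹ with hT
  set L := e.diag fun i => √(l i) with hL
  have hLT : L ∘ T =ᵐ[μ] id := by
    have hnull : ∀ᵐ x ∂μ, ∀ i, l i = 0 → inner ℝ (e i) x = 0 := by
      refine ae_all_iff.2 fun i => ?_
      by_cases hi : l i = 0
      swap
      · exact ae_of_all _ fun x h => absurd h hi
      have h1 := hcov (e i)
      rw [Finset.sum_eq_zero, integral_eq_zero_iff_of_nonneg (fun x => sq_nonneg _)
        (hμ.memLp_inner (e i)).integrable_sq] at h1
      · filter_upwards [h1] with x hx _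
        rw [real_inner_comm]
        exact pow_eq_zero_iff (two_ne_zero) |>.1 hx
      · intro j _
        by_cases hj : j = i
        · simp [hj, hi]
        · simp [e.orthonormal.2 hj]
    filter_upwards [hnull] with x hx
    rw [Function.comp_apply, hT, hL, e.diag_diag, e.diag_apply, id]
    conv_rhs => rw [← e.sum_repr' x]
    refine Finset.sum_congr rfl fun i _ => ?_
    rcases (hl i).eq_or_lt with h | h
    · simp [hx i h.symm]
    · have : √(l i) ≠ 0 := (Real.sqrt_pos.2 h).ne'
      simp [this]
  -- Induction over null eigenvectors: each smearing supplies one missing unit of variance, and `L`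
  -- kills that direction, so the image remains `μ`.
  have main (s : Finset (Fin n)) : (∀ i ∈ s, l i = 0) →
      ∃ ν : Measure (EuclideanSpace ℝ (Fin n)), IsProbabilityMeasure ν ∧ IsLogConcave ν ∧
        (∀ θ, ∫ x, inner ℝ x θ ∂ν = 0) ∧
        (∀ θ, ∫ x, inner ℝ x θ ^ 2 ∂ν =
          ∑ i, (if l i = 0 then 0 else inner ℝ (e i) θ ^ 2) + ∑ i ∈ s, inner ℝ (e i) θ ^ 2) ∧
        ν.map L = μ := by
    classical
    induction s using Finset.induction_on with
    | empty =>
      intro _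
      refine ⟨μ.map T, Measure.isProbabilityMeasure_map (by fun_prop), hμ.map_linear T,
        fun θ => ?_, fun θ => ?_, ?_⟩
      · rw [integral_inner_map T (fun u => u) (by fun_prop)]
        simp_rw [hT, e.inner_diag_comm]
        exact hμ0 _
      · rw [integral_inner_map T (fun u => u ^ 2) (by fun_prop)]
        simp_rw [hT, e.inner_diag_comm]
        rw [hcov, Finset.sum_empty, add_zero]
        refine Finset.sum_congr rfl fun i _ => ?_
        rw [e.inner_diag]
        split_ifs with h
        · simp [h]
        · rw [mul_pow, inv_pow, Real.sq_sqrt (hl i), mul_inv_cancel_left₀ h]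
      · rw [Measure.map_map (by fun_prop) (by fun_prop), Measure.map_congr hLT, Measure.map_id]
    | insert i s his ih =>
      intro hs
      obtain ⟨ν, hν, hνlc, hν0, hν2, hνL⟩ := ih fun j hj => hs j (Finset.mem_insert_of_mem hj)
      refine ⟨uniformSmear ν (e i), inferInstance, hνlc.smear (e i), fun θ => ?_,
        fun θ => ?_, ?_⟩
      · rw [integral_inner_uniformSmear _ _ hνlc.memLp_id, hν0]
      · rw [integral_inner_sq_uniformSmear _ _ hνlc.memLp_id (hν0 θ), hν2,
          Finset.sum_insert his]
        ring
      · have hLe : L (e i) = 0 := by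
          rw [hL, e.diag_self, hs i (Finset.mem_insert_self i s)]; simp
        rw [uniformSmear, Measure.map_map (by fun_prop) (by fun_prop)]
        have : (L ∘ fun p : EuclideanSpace ℝ (Fin n) × ℝ => p.1 + p.2 • e i) = L ∘ Prod.fst := by
          ext1 p; simp [hLe]
        rw [this, ← Measure.map_map (by fun_prop) measurable_fst, Measure.map_fst_prod]
        simpa using hνL
  obtain ⟨ν, hν, hνlc, hν0, hν2, hνL⟩ := main (Finset.univ.filter fun i => l i = 0) (by simp)
  refine ⟨ν, hν, fun θ => ⟨hν0 θ, ?_⟩, hνlc, L, hνL⟩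
  rw [hν2, Finset.sum_filter, ← Finset.sum_add_distrib, ← e.sum_sq_norm_inner_right θ]
  refine Finset.sum_congr rfl fun i _ => ?_
  split_ifs <;> simp

/-- Hahn–Banach: the functional `c • y ↦ c * N y` on the line through `y` is dominated by `N` and
extends. -/
theorem Seminorm.exists_inner_eq (N : Seminorm ℝ (EuclideanSpace ℝ (Fin n)))
    (y : EuclideanSpace ℝ (Fin n)) : ∃ θ, inner ℝ y θ = N y ∧ ∀ x, |inner ℝ x θ| ≤ N x := by
  by_cases hy : y = 0
  · exact ⟨0, by simp [hy], fun x => by simp⟩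
  obtain ⟨g, hg, hgN⟩ := exists_extension_of_le_sublinear (LinearPMap.mkSpanSingleton y (N y) hy) N
    (fun c hc x => by rw [map_smul_eq_mul, Real.norm_of_nonneg hc.le]) (map_add_le_add N) (by
      rintro ⟨x, hx⟩
      obtain ⟨c, rfl⟩ := Submodule.mem_span_singleton.1 hx
      rw [LinearPMap.mkSpanSingleton'_apply, map_smul_eq_mul, smul_eq_mul]
      exact mul_le_mul_of_nonneg_right (le_abs_self c) (apply_nonneg N y))
  have hrep (x) : inner ℝ x ((InnerProductSpace.toDual ℝ _).symm g.toContinuousLinearMap) = g x := by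
    rw [real_inner_comm, InnerProductSpace.toDual_symm_apply]; rfl
  refine ⟨(InnerProductSpace.toDual ℝ _).symm g.toContinuousLinearMap, ?_, fun x => ?_⟩
  · rw [hrep]
    have := hg ⟨y, Submodule.mem_span_singleton_self y⟩
    rw [this]
    exact LinearPMap.mkSpanSingleton_apply ℝ ℝ hy (N y)
  · rw [hrep]
    exact N.abs_le_of_le hgN x

theorem seminorm_comp_le {μ ν : Measure (EuclideanSpace ℝ (Fin n))} [IsProbabilityMeasure μ]
    (hμ : IsLogConcave μ) (hν : IsIsotropic ν)
    {L : EuclideanSpace ℝ (Fin n) →L[ℝ] EuclideanSpace ℝ (Fin n)} (hL : ν.map L = μ)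
    (N : Seminorm ℝ (EuclideanSpace ℝ (Fin n))) {K : ℝ} (hK : 0 ≤ K)
    (hN : ∫ x, N x ^ 2 ∂μ ≤ K ^ 2) (x : EuclideanSpace ℝ (Fin n)) : N (L x) ≤ K * ‖x‖ := by
  obtain ⟨θ, hθ, hθN⟩ := N.exists_inner_eq (L x)
  have h1 : ‖L.adjoint θ‖ ^ 2 ≤ K ^ 2 := by
    rw [← (hν _).2]
    simp_rw [ContinuousLinearMap.adjoint_inner_right]
    rw [← integral_inner_map L (fun u => u ^ 2) (by fun_prop), hL]
    refine (integral_mono (hμ.memLp_inner θ).integrable_sq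
      (hμ.memLp_seminorm N).integrable_sq fun z => ?_).trans hN
    exact sq_le_sq' ((abs_le.1 (hθN z)).1) (abs_le.1 (hθN z)).2
  rw [← hθ, ← ContinuousLinearMap.adjoint_inner_right]
  refine (real_inner_le_norm _ _).trans ?_
  rw [mul_comm]
  exact mul_le_mul_of_nonneg_right (le_of_sq_le_sq h1 hK) (norm_nonneg x)

end IsotropicLift

/-! ### Concentration of semi-norms and the extended-real form -/

theorem inv_klsConstant_le_cheegerConstant {n : ℕ} {ν : Measure (EuclideanSpace ℝ (Fin n))}
    (hν : IsProbabilityMeasure ν) (hiso : IsIsotropic ν) (hlc : IsLogConcave ν) :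
    (klsConstant n)⁻¹ ≤ cheegerConstant ν := by
  rw [ENNReal.inv_le_iff_inv_le]
  exact le_iSup_of_le ν (le_iSup_of_le hν (le_iSup_of_le hiso (le_iSup_of_le hlc le_rfl)))

theorem exists_measureReal_seminorm_sub_gt_le : ∃ C : ℝ, 0 < C ∧
    ∀ {n : ℕ} {μ : Measure (EuclideanSpace ℝ (Fin n))} [IsProbabilityMeasure μ],
      IsLogConcave μ → (∀ θ, ∫ x, inner ℝ x θ ∂μ = 0) →
      ∀ (N : Seminorm ℝ (EuclideanSpace ℝ (Fin n))), 0 < ∫ x, N x ∂μ →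
      ∀ h : ℝ, 0 < h → ENNReal.ofReal h ≤ (klsConstant n)⁻¹ → ∀ t : ℝ,
        μ.real {x | t < |N x - ∫ y, N y ∂μ|} ≤
          2 * Real.exp (-(C * h * (t / ∫ y, N y ∂μ))) := by
  obtain ⟨C, hC, hCN⟩ := exists_integral_seminorm_sq_le
  -- `C` is the reverse Hölder constant entering the Lipschitz bound; `3` is the exponent loss in
  -- concentration about the mean.
  refine ⟨(3 * C)⁻¹, by positivity, fun {n μ} _ hμ hμ0 N hm h hh hkls t => ?_⟩
  obtain ⟨ν, hν, hiso, hlc, L, hL⟩ := hμ.exists_isotropic_lift hμ0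
  have hNc := N.continuous_euclidean
  have hlip := seminorm_comp_le hμ hiso hL N (by positivity) (hCN hμ N hm)
  have hint : Integrable (fun x => N (L x)) ν := by
    refine Integrable.comp_measurable (f := L) (g := N) ?_ (by fun_prop)
    rw [hL]
    exact (hμ.memLp_seminorm N).integrable (by norm_num)
  have hmean : ∫ x, N (L x) ∂ν = ∫ x, N x ∂μ := by
    rw [← hL, integral_map (by fun_prop) hNc.aestronglyMeasurable]
  set m := ∫ x, N x ∂μ with hm_def
  have hCm : 0 < C * m := by positivity
  have hf : LipschitzWith 1 fun x => (C * m)⁻¹ * N (L x) := by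
    refine LipschitzWith.of_dist_le_mul fun x y => ?_
    rw [NNReal.coe_one, one_mul, Real.dist_eq, ← mul_sub, abs_mul, abs_of_pos (inv_pos.2 hCm),
      inv_mul_le_iff₀ hCm, dist_eq_norm]
    refine (abs_sub_map_le_sub N (L x) (L y)).trans ?_
    rw [← map_sub]
    exact hlip _
  have key := measureReal_abs_sub_integral_gt_le
    (hkls.trans (inv_klsConstant_le_cheegerConstant hν hiso hlc)) hh hf
    (hint.const_mul (C * m)⁻¹) ((C * m)⁻¹ * t)
  rw [integral_const_mul, hmean] at key
  simp_rw [← mul_sub, abs_mul, abs_of_pos (inv_pos.2 hCm),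
    mul_lt_mul_iff_right₀ (inv_pos.2 hCm)] at key
  have hset : μ.real {x | t < |N x - m|} = ν.real {x | t < |N (L x) - m|} := by
    rw [← hL, map_measureReal_apply (by fun_prop)
      (measurableSet_lt measurable_const (by fun_prop))]
    rfl
  rw [hset]
  refine key.trans (le_of_eq ?_)
  congr 3
  field_simp

theorem integral_inner_eq_zero_of_map_neg {n : ℕ} {μ : Measure (EuclideanSpace ℝ (Fin n))}
    (hμ : μ.map Neg.neg = μ) (θ : EuclideanSpace ℝ (Fin n)) : ∫ x, inner ℝ x θ ∂μ = 0 := by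
  have h : ∫ x, inner ℝ x θ ∂μ = ∫ x, inner ℝ (-x) θ ∂μ := by
    conv_lhs => rw [← hμ]
    exact integral_map (by fun_prop) (by fun_prop)
  simp_rw [inner_neg_left, integral_neg] at h
  linarith

/-- Here `w` stands for `1 / ψ_n`. For `w = 0` the bound is trivial, for finite `w` the rate `h = w`
is admissible, and for `w = ∞` letting `h → ∞` forces `p ≤ 0`. -/
theorem ENNReal.le_two_mul_exp_neg {p : ℝ} (hp1 : p ≤ 1) {w : ℝ≥0∞} {c k : ℝ}
    (hc : 0 < c) (hk : 0 < k)
    (hp : ∀ h : ℝ, 0 < h → ENNReal.ofReal h ≤ w → p ≤ 2 * Real.exp (-(c * h * k))) :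
    ENNReal.ofReal p ≤
      2 * EReal.exp (-((ENNReal.ofReal c * w * ENNReal.ofReal k : ℝ≥0∞) : EReal)) := by
  rcases eq_or_ne w 0 with rfl | hw0
  · simp only [mul_zero, zero_mul, EReal.coe_ennreal_zero, neg_zero, EReal.exp_zero, mul_one]
    exact (ENNReal.ofReal_le_one.2 hp1).trans (by norm_num)
  rcases eq_or_ne w ∞ with rfl | hw
  · have hlim : Tendsto (fun h : ℝ => 2 * Real.exp (-(c * h * k))) atTop (𝓝 (2 * 0)) := by
      refine Filter.Tendsto.const_mul (2 : ℝ) (Real.tendsto_exp_neg_atTop_nhds_zero.comp ?_)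
      exact (tendsto_id.const_mul_atTop hc).atTop_mul_const hk
    have hle : p ≤ 2 * 0 := ge_of_tendsto hlim
      ((eventually_gt_atTop 0).mono fun h hh => hp h hh le_top)
    rw [ENNReal.ofReal_eq_zero.2 (by linarith)]
    exact zero_le
  · have hwpos : 0 < w.toReal := ENNReal.toReal_pos hw0 hw
    have h := hp w.toReal hwpos (ENNReal.ofReal_toReal hw).le
    rw [← ENNReal.ofReal_toReal hw, ← ENNReal.ofReal_mul hc.le, ← ENNReal.ofReal_mul (by positivity),
      EReal.coe_ennreal_ofReal, max_eq_left (by positivity), ← EReal.coe_neg, EReal.exp_coe]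
    refine (ENNReal.ofReal_le_ofReal h).trans (le_of_eq ?_)
    rw [ENNReal.ofReal_mul (by norm_num), ENNReal.ofReal_ofNat]

theorem corollary1p4 :
    ∃ c : ℝ, 0 < c ∧
      ∀ (n : ℕ) (N : Seminorm ℝ (EuclideanSpace ℝ (Fin n)))
        (Ω : Type*) [MeasurableSpace Ω] (P : Measure Ω) [IsProbabilityMeasure P]
        (Z : Ω → EuclideanSpace ℝ (Fin n)),
        AEMeasurable Z P →
        P.map (fun ω => -Z ω) = P.map Z →
        IsLogConcave (P.map Z) →
        Integrable (fun ω => N (Z ω)) P ∧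
        ∀ t : ℝ, 0 < t →
          P {ω | |N (Z ω) - ∫ ω', N (Z ω') ∂P| > t} ≤
            2 * EReal.exp (-((ENNReal.ofReal c / klsConstant n *
              (ENNReal.ofReal t / ENNReal.ofReal (∫ ω', N (Z ω') ∂P)) : ℝ≥0∞) : EReal)) := by
  obtain ⟨C, hC, hmain⟩ := exists_measureReal_seminorm_sub_gt_le
  refine ⟨C, hC, fun n N Ω _ P _ Z hZ hsymm hlc => ?_⟩
  have hprob : IsProbabilityMeasure (P.map Z) := Measure.isProbabilityMeasure_map hZ
  have hNc := N.continuous_euclidean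
  have hint : Integrable (fun ω => N (Z ω)) P :=
    ((hlc.memLp_seminorm N).integrable (by norm_num)).comp_aemeasurable hZ
  have hmean : ∫ ω, N (Z ω) ∂P = ∫ x, N x ∂P.map Z :=
    (integral_map hZ hNc.aestronglyMeasurable).symm
  have hneg : (P.map Z).map Neg.neg = P.map Z := by
    rw [AEMeasurable.map_map_of_aemeasurable (by fun_prop) hZ]
    exact hsymm
  refine ⟨hint, fun t ht => ?_⟩
  have hm0 : 0 ≤ ∫ ω, N (Z ω) ∂P := integral_nonneg fun ω => apply_nonneg N _
  rcases hm0.eq_or_lt with hm | hm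
  -- With mean zero, `N (Z ω)` vanishes almost surely, so the left side is `0` whatever the
  -- conventions make of the right.
  · have hae := (integral_eq_zero_iff_of_nonneg (fun ω => apply_nonneg N (Z ω)) hint).1 hm.symm
    have hnull : P {ω | |N (Z ω) - ∫ ω', N (Z ω') ∂P| > t} = 0 := by
      refine measure_mono_null (fun ω hω => ?_) hae
      intro h0
      have h0 : N (Z ω) = 0 := h0
      have hω : |N (Z ω) - ∫ ω', N (Z ω') ∂P| > t := hω
      rw [h0, ← hm, sub_zero, abs_zero] at hω
      linarith
    rw [hnull]
    exact zero_le
  · have hset : P {ω | |N (Z ω) - ∫ ω', N (Z ω') ∂P| > t} =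
        ENNReal.ofReal ((P.map Z).real {x | t < |N x - ∫ y, N y ∂P.map Z|}) := by
      rw [ofReal_measureReal, Measure.map_apply_of_aemeasurable hZ
        (measurableSet_lt measurable_const (by fun_prop)), ← hmean]
      rfl
    rw [hset, div_eq_mul_inv (ENNReal.ofReal C), ← ENNReal.ofReal_div_of_pos hm]
    rw [hmean] at hm ⊢
    exact ENNReal.le_two_mul_exp_neg measureReal_le_one hC (div_pos ht hm)
      fun h hh hkls => hmain hlc (integral_inner_eq_zero_of_map_neg hneg) N hm h hh hkls t
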